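/- **Conventions.** For a real number $\kappa>0$ write $a\ll_\kappa b$ for $a<\kappa b$, write $a\approx_\kappa b$ for $|a-b|\ll_\kappa a$, and write $a\lesssim_\kappa b$ for $a<(1+\kappa)b$. For a bipartite graph $B$ on $X\cup Y$, $\overline B$ denotes its bipartite complement, $|\overline B|$ the number of edges of $\overline B$, and $d_{\overline B}(x)$ the degree of $x$ in $\overline B$. A matching is $X$-perfect if it uses all vertices of $X$. **Lemma 7.3.** For all real $\delta'>0$ and $b>0$ there is a $\kappa>0$ such that for every fixed $\varepsilon>0$ and every $c>0$ there is a $D_0$ for which the following holds. Let $D\ge D_0$ and $n\ge D$ be integers, let $t$ be $(1+\delta')\ln n$ rounded to an integer (that is, $t\ge 0$ is an integer with $|t-(1+\delta')\ln n|<1$), and let $\zeta_0,\zeta,\eta$ be real numbers with $$\varepsilon\ll_\kappa \zeta_0D\ll_\kappa 1 .$$ Let $B$ be a bipartite graph on $X\cup Y$, where $|X|=J\approx_\kappa D$ and $|Y|=J+R$ with integers $J,R\ge 0$ and $t\le J+R$. Assume that $d_{\overline B}(x)\le b\,\varepsilon D$ for all $x\in X$, that $|\overline B|\le 2\zeta D^2$,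 and that (a) $R=0$ if $\zeta<\zeta_0$ ("$\zeta$ is small"); (b) if $\zeta\ge\zeta_0$ ("$\zeta$ is large"), then $\max\{\zeta,1/D\}\ll_\kappa\eta\ll_\kappa\zeta/\varepsilon$, $\ R\ll_\kappa D$ and $\ \eta D\lesssim_\kappa R$. Choose independently for each $x\in X$ a set $M_x$ uniformly from the $t$-element subsets of $Y$, and let $K$ be the random subgraph of $B$ in which $x\in X$ and $y\in Y$ are adjacent if and only if $xy\in B$ and $y\in M_x$. Then $$\Pr(K\text{ has an }X\text{-perfect matching})\ \ge\ 1-c\,\frac Dn .$$ (So, for fixed $\delta',b,\varepsilon$, the probability is $1-o(D/n)$ as $D\to\infty$, uniformly in all other data.) -/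

import Mathlib

universe u v

/-- The finitary counterpart `a ≪ b` of `a = o(b)`, with the (small) constant `κ`. -/
def MuchLess (κ a b : ℝ) : Prop := a < κ * b

/-- The finitary counterpart `a ≈ b` of `a ∼ b`: `|a - b| ≪ a`. -/
def ApproxEq (κ a b : ℝ) : Prop := MuchLess κ |a - b| a

/-- The finitary counterpart `a ≲ b` of `a < (1 + o(1)) b`. -/
def ApproxLE (κ a b : ℝ) : Prop := a < (1 + κ) * b

/-- The bipartite complement of a bipartite graph `B` on `X ∪ Y`. -/
def bipCompl {X Y : Type*} (B : SimpleGraph (X ⊕ Y)) : SimpleGraph (X ⊕ Y) :=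
  completeBipartiteGraph X Y \ B

/-- The subgraph `K` of `B` in which `x ∈ X` keeps exactly its edges to members of its list `M x`. -/
def listSubgraph {X Y : Type*} (B : SimpleGraph (X ⊕ Y)) (M : X → Finset Y) :
    SimpleGraph (X ⊕ Y) :=
  B ⊓ SimpleGraph.fromRel (fun a b => ∃ x, ∃ y ∈ M x, a = Sum.inl x ∧ b = Sum.inr y)

theorem listSubgraph_adj {X Y : Type*} (B : SimpleGraph (X ⊕ Y)) (M : X → Finset Y)
    (x : X) (y : Y) :
    (listSubgraph B M).Adj (Sum.inl x) (Sum.inr y) ↔ B.Adj (Sum.inl x) (Sum.inr y) ∧ y ∈ M x := by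
  simp [listSubgraph]

/-- `K` has a matching that uses all vertices of `X`. -/
def HasXPerfectMatching {X Y : Type*} (K : SimpleGraph (X ⊕ Y)) : Prop :=
  ∃ P : K.Subgraph, P.IsMatching ∧ ∀ x : X, Sum.inl x ∈ P.verts

/-- The law of a family of independent lists `M x` (`x ∈ X`), each of them uniform among the
`t`-element subsets of `Y`. -/
noncomputable def listLaw (X Y : Type*) [Fintype X] (t : ℕ) :
    MeasureTheory.Measure (X → Finset Y) :=
  MeasureTheory.Measure.pi (fun _ : X => ProbabilityTheory.uniformOn {S : Finset Y | S.card = t})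

/-! If there is no `X`-perfect matching, a smallest Hall obstruction on the side of `Y` consists of
`T ⊆ Y` and `W ⊆ X` with |T| = |W| + R + 1 such that each x ∈ W has at least two `K`-neighbours in T
and no other x has any (`exists_tight_obstruction`). The lists are independent, so a union bound
over (T, W) leaves a sum of products (`one_sub_sum_le_listLaw`). Write N = |Y|.

For |T| ≤ θN, `B` has at least (1 - g)|T|N edges between T and X ∖ W, so the untouched vertices
contribute exp(-(1 - g)t|T|), roughly n^(-(1 + δ'/2)|T|). The double contacts contribute
(|T|t/N)^(2|W|), so summing over W costs only (e t²)^|T|; single contacts could cost about e^(t|T|)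
and destroy the gain. The sum over T is then of the order of its singleton terms, N t² n^(-(1 +
δ'/2)) = o(D/n).

For larger T, every x outside W sees all but few vertices of T. If |X ∖ W| ≥ N/200, the product is
exponentially small in tN and beats the at most 4^N pairs. Otherwise T is nearly all of Y, each x
outside W contributes at most e^(-4t), and |Y ∖ T| = |X ∖ W| - 1 keeps the sum of order N² e^(-4t).

The edge bound (`le_sum_card_adj`) needs that at most θR < |T| vertices of `Y` miss more than θD
edges; `parameter_bounds` extracts this from the alternative between small and large ζ. -/

/-! ### Hall's theorem and tight obstructions -/

/-- An injective choice of neighbours is an `X`-perfect matching. -/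
theorem hasXPerfectMatching_of_injective {X Y : Type*} {K : SimpleGraph (X ⊕ Y)} (f : X → Y)
    (hf : Function.Injective f) (hK : ∀ x, K.Adj (Sum.inl x) (Sum.inr (f x))) :
    HasXPerfectMatching K := by
  refine ⟨{ verts := {v | (∃ x, v = Sum.inl x) ∨ ∃ x, v = Sum.inr (f x)}
            Adj := fun v w => ∃ x, (v = Sum.inl x ∧ w = Sum.inr (f x)) ∨
              (w = Sum.inl x ∧ v = Sum.inr (f x))
            adj_sub := ?_
            edge_vert := ?_
            symm := ?_ }, ?_, ?_⟩
  · rintro v w ⟨x, ⟨rfl, rfl⟩ | ⟨rfl, rfl⟩⟩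
    · exact hK x
    · exact (hK x).symm
  · rintro v w ⟨x, ⟨rfl, rfl⟩ | ⟨rfl, rfl⟩⟩
    · exact Or.inl ⟨x, rfl⟩
    · exact Or.inr ⟨x, rfl⟩
  · constructor
    rintro v w ⟨x, h⟩
    exact ⟨x, h.symm⟩
  · rintro v (⟨x, rfl⟩ | ⟨x, rfl⟩)
    · refine ⟨Sum.inr (f x), ⟨x, Or.inl ⟨rfl, rfl⟩⟩, ?_⟩
      rintro w ⟨x', ⟨h, rfl⟩ | ⟨-, h⟩⟩
      · rw [Sum.inl.inj h]
      · simp at h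
    · refine ⟨Sum.inl x, ⟨x, Or.inr ⟨rfl, rfl⟩⟩, ?_⟩
      rintro w ⟨x', ⟨h, -⟩ | ⟨rfl, h⟩⟩
      · simp at h
      · rw [hf (Sum.inr.inj h)]
  · exact fun x => Or.inl ⟨x, rfl⟩

open Finset in
/-- A family of subsets of `Y` without a system of distinct representatives has a tight
obstruction `T ⊆ Y`, touched at least twice by each of the members `W` that it touches at all. -/
theorem exists_tight_obstruction {X Y : Type*} [Fintype X] [Fintype Y] [DecidableEq X]
    [DecidableEq Y] {R : ℕ} (hcard : Fintype.card Y = Fintype.card X + R) (F : X → Finset Y)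
    (hF : ¬ ∃ f : X → Y, Function.Injective f ∧ ∀ x, f x ∈ F x) :
    ∃ (T : Finset Y) (W : Finset X), #W + R + 1 = #T ∧ (∀ x ∈ W, 2 ≤ #(F x ∩ T)) ∧
      ∀ x ∉ W, Disjoint (F x) T := by
  let N : Finset Y → Finset X := fun T => univ.filter fun x => (F x ∩ T).Nonempty
  let 𝒯 : Finset (Finset Y) := univ.filter fun T => #(N T) + R + 1 ≤ #T
  have hne : 𝒯.Nonempty := by
    rw [← Finset.all_card_le_biUnion_card_iff_exists_injective] at hF
    push Not at hF
    obtain ⟨A, hA⟩ := hF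
    -- The vertices of `Y` missed by a Hall violator `A` are touched only from outside `A`; passing
    -- to this side brings in the surplus `R`.
    refine ⟨(A.biUnion F)ᶜ, ?_⟩
    have h1 : N (A.biUnion F)ᶜ ⊆ Aᶜ := by
      intro x hx
      obtain ⟨y, hy⟩ := (Finset.mem_filter.mp hx).2
      simp only [mem_inter, mem_compl, mem_biUnion, not_exists, not_and] at hy ⊢
      exact fun hxA => hy.2 x hxA hy.1
    have h2 := card_le_card h1
    rw [card_compl] at h2
    have h3 : #A ≤ Fintype.card X := card_le_univ A
    have h4 : #(A.biUnion F) ≤ Fintype.card Y := card_le_univ _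
    simp only [𝒯, mem_filter, mem_univ, true_and, card_compl]
    omega
  obtain ⟨T, hT, hmin⟩ := exists_min_image 𝒯 (fun T => #T) hne
  have hT' : #(N T) + R + 1 ≤ #T := (mem_filter.mp hT).2
  have herase : ∀ y ∈ T, ¬ (#(N (T.erase y)) + R + 1 ≤ #(T.erase y)) := by
    intro y hy h
    have h1 := hmin (T.erase y) (mem_filter.mpr ⟨mem_univ _, h⟩)
    have h2 := card_erase_lt_of_mem hy
    omega
  have hmono : ∀ y, N (T.erase y) ⊆ N T := fun y x hx => by
    simp only [N, mem_filter, mem_univ, true_and] at hx ⊢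
    exact hx.mono (inter_subset_inter_left (erase_subset _ _))
  refine ⟨T, N T, ?_, ?_, ?_⟩
  · obtain ⟨y, hy⟩ : T.Nonempty := card_pos.mp (by omega)
    have h1 := herase y hy
    have h2 := card_le_card (hmono y)
    have h3 := card_erase_of_mem hy
    omega
  · intro x hx
    by_contra hlt
    have hne : (F x ∩ T).Nonempty := (mem_filter.mp hx).2
    have h1 : #(F x ∩ T) = 1 := by have := hne.card_pos; omega
    obtain ⟨y, hy⟩ := card_eq_one.mp h1
    have hyT : y ∈ T := (mem_inter.mp (hy ▸ mem_singleton_self y : y ∈ F x ∩ T)).2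
    -- If `x` meets `T` in `y` alone, erasing `y` also loses `x`: both sides of the deficiency
    -- inequality drop by at least and exactly one, against minimality.
    have h2 : N (T.erase y) ⊆ (N T).erase x := by
      intro x' hx'
      refine mem_erase.mpr ⟨?_, hmono y hx'⟩
      rintro rfl
      obtain ⟨y', hy'⟩ := (mem_filter.mp hx').2
      simp only [mem_inter, mem_erase] at hy'
      have : y' ∈ F x' ∩ T := mem_inter.mpr ⟨hy'.1, hy'.2.2⟩
      rw [hy, mem_singleton] at this
      exact hy'.2.1 this
    have h3 := card_le_card h2
    rw [card_erase_of_mem hx] at h3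
    have h4 := card_pos.mpr ⟨x, hx⟩
    have h5 := card_erase_of_mem hyT
    have h6 := herase y hyT
    omega
  · intro x hx
    simp only [N, mem_filter, mem_univ, true_and, not_nonempty_iff_eq_empty] at hx
    exact disjoint_iff_inter_eq_empty.mpr hx

/-! ### Hitting probabilities of a uniform `t`-subset -/

/-- Each factor satisfies (K - i)/(N - i) ≤ K/N: sampling without replacement avoids a set no more
often than sampling with replacement. -/
theorem descFactorial_mul_pow_le {K N : ℕ} (h : K ≤ N) (t : ℕ) :
    K.descFactorial t * N ^ t ≤ K ^ t * N.descFactorial t := by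
  induction t with
  | zero => simp
  | succ t ih =>
    rw [Nat.descFactorial_succ, Nat.descFactorial_succ, pow_succ, pow_succ]
    have h1 : (K - t) * N ≤ K * (N - t) := by
      rw [Nat.sub_mul, Nat.mul_sub]
      have : K * t ≤ t * N := by rw [mul_comm K]; exact Nat.mul_le_mul_left _ h
      omega
    calc (K - t) * K.descFactorial t * (N ^ t * N)
        = ((K - t) * N) * (K.descFactorial t * N ^ t) := by ring
      _ ≤ (K * (N - t)) * (K ^ t * N.descFactorial t) := Nat.mul_le_mul h1 ih
      _ = _ := by ring

theorem choose_sub_div_choose_le {u N t : ℕ} (hu : u ≤ N) (htN : t ≤ N) (hN : 0 < N) :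
    ((N - u).choose t : ℝ) / (N.choose t) ≤ (1 - (u : ℝ) / N) ^ t := by
  have hN' : (0 : ℝ) < N := by exact_mod_cast hN
  have hc : (0 : ℝ) < N.choose t := by exact_mod_cast Nat.choose_pos htN
  have h1 : (1 - (u : ℝ) / N) = ((N - u : ℕ) : ℝ) / N := by
    rw [Nat.cast_sub hu]; field_simp
  rw [h1, div_pow, div_le_div_iff₀ hc (by positivity)]
  have h := descFactorial_mul_pow_le (Nat.sub_le N u) t
  rw [Nat.descFactorial_eq_factorial_mul_choose, Nat.descFactorial_eq_factorial_mul_choose] at h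
  have h2 : (N - u).choose t * N ^ t ≤ (N - u) ^ t * N.choose t := by
    refine Nat.le_of_mul_le_mul_left ?_ (Nat.factorial_pos t)
    linarith
  exact_mod_cast h2

open Finset in
theorem card_powersetCard_filter_superset_le {Y : Type*} [Fintype Y] [DecidableEq Y] (t : ℕ)
    (P : Finset Y) :
    #((powersetCard t univ).filter fun M => P ⊆ M) ≤ (Fintype.card Y - #P).choose (t - #P) := by
  have : #(powersetCard (t - #P) Pᶜ) = (Fintype.card Y - #P).choose (t - #P) := by
    rw [card_powersetCard, card_compl]
  rw [← this]
  refine card_le_card_of_injOn (fun M => M \ P) ?_ ?_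
  · intro M hM
    simp only [coe_filter, mem_powersetCard, subset_univ, true_and, Set.mem_ofPred_eq] at hM
    simp only [mem_coe, mem_powersetCard, card_sdiff_of_subset hM.2, hM.1, and_true]
    intro y hy
    exact mem_compl.mpr (mem_sdiff.mp hy).2
  · intro M hM M' hM' h
    simp only [coe_filter, mem_powersetCard, subset_univ, true_and, Set.mem_ofPred_eq] at hM hM'
    rw [← sdiff_union_of_subset hM.2, ← sdiff_union_of_subset hM'.2]
    exact congrArg (· ∪ P) h

-- Union bound over the pairs in `T`: a given pair lies in the random set with probability t(t -
-- 1)/(N(N - 1)) ≤ (t/N)².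
open Finset in
theorem card_filter_two_le_inter_div_le {Y : Type*} [Fintype Y] [DecidableEq Y] {t : ℕ}
    (ht : t ≤ Fintype.card Y) (T : Finset Y) :
    (#((powersetCard t univ).filter fun M => 2 ≤ #(M ∩ T)) : ℝ) / (Fintype.card Y).choose t ≤
      ((#T : ℝ) * t / Fintype.card Y) ^ 2 := by
  set N := Fintype.card Y
  by_cases ht2 : t < 2
  · have : ((powersetCard t univ).filter fun M => 2 ≤ #(M ∩ T)) = ∅ := by
      refine filter_eq_empty_iff.mpr fun M hM => ?_
      have h1 := (mem_powersetCard.mp hM).2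
      have h2 : #(M ∩ T) ≤ #M := card_le_card inter_subset_left
      omega
    rw [this]
    simp only [card_empty, Nat.cast_zero, zero_div]
    positivity
  have hc : (0 : ℝ) < N.choose t := by exact_mod_cast Nat.choose_pos ht
  have h1 : #((powersetCard t univ).filter fun M => 2 ≤ #(M ∩ T)) ≤
      (#T).choose 2 * (N - 2).choose (t - 2) := by
    calc _ ≤ #((powersetCard 2 T).biUnion fun P => (powersetCard t univ).filter fun M => P ⊆ M) := by
            refine card_le_card fun M hM => ?_
            obtain ⟨hM, h⟩ := mem_filter.mp hM
            obtain ⟨P, hP, hPc⟩ := exists_subset_card_eq h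
            exact mem_biUnion.mpr ⟨P, mem_powersetCard.mpr ⟨hP.trans inter_subset_right, hPc⟩,
              mem_filter.mpr ⟨hM, hP.trans inter_subset_left⟩⟩
      _ ≤ #(powersetCard 2 T) * (N - 2).choose (t - 2) := by
            refine card_biUnion_le_card_mul _ _ _ fun P hP => ?_
            have := card_powersetCard_filter_superset_le t P
            rwa [(mem_powersetCard.mp hP).2] at this
      _ = _ := by rw [card_powersetCard]
  have h2 : N.choose t * t.choose 2 = N.choose 2 * (N - 2).choose (t - 2) :=
    Nat.choose_mul (by omega) 
  have hN2 : (2 : ℝ) ≤ N := by exact_mod_cast (by omega : 2 ≤ N)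
  have ht2' : (2 : ℝ) ≤ t := by exact_mod_cast (by omega : 2 ≤ t)
  have htN : (t : ℝ) ≤ N := by exact_mod_cast ht
  have h2' : (N.choose t : ℝ) * (t * (t - 1)) = N * (N - 1) * (N - 2).choose (t - 2) := by
    have : ((N.choose t * t.choose 2 : ℕ) : ℝ) = (N.choose 2 * (N - 2).choose (t - 2) : ℕ) := by
      rw [h2]
    push_cast [Nat.cast_choose_two] at this
    linarith
  have h3 : (#((powersetCard t univ).filter fun M => 2 ≤ #(M ∩ T)) : ℝ) ≤
      (#T : ℝ) ^ 2 * (N - 2).choose (t - 2) := by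
    calc _ ≤ (((#T).choose 2 * (N - 2).choose (t - 2) : ℕ) : ℝ) := by exact_mod_cast h1
      _ ≤ _ := by
        push_cast
        gcongr
        exact_mod_cast Nat.choose_le_pow _ _
  rw [div_le_iff₀ hc]
  refine h3.trans ?_
  have h4 : ((N - 2).choose (t - 2) : ℝ) ≤ ((t : ℝ) / N) ^ 2 * N.choose t := by
    have h5 : ((N - 2).choose (t - 2) : ℝ) = N.choose t * (t * (t - 1)) / (N * (N - 1)) := by
      rw [h2']
      field_simp [(by linarith : (N : ℝ) - 1 ≠ 0)]
    rw [h5, div_pow, div_mul_eq_mul_div, div_le_div_iff₀ (by nlinarith) (by nlinarith)]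
    have : (t * (t - 1) : ℝ) * N ^ 2 ≤ t ^ 2 * (N * (N - 1)) := by
      have : 0 ≤ (t : ℝ) * N * (N - t) := by
        have : 0 ≤ (N : ℝ) - t := by linarith
        positivity
      nlinarith
    nlinarith
  calc (#T : ℝ) ^ 2 * (N - 2).choose (t - 2) ≤ (#T : ℝ) ^ 2 * (((t : ℝ) / N) ^ 2 * N.choose t) := by
        gcongr
    _ = _ := by rw [mul_div_assoc, mul_pow, mul_assoc]

open Finset MeasureTheory ProbabilityTheory in
theorem uniformOn_card_eq_real {Y : Type*} [Fintype Y] [DecidableEq Y] (t : ℕ)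
    (p : Finset Y → Prop) [DecidablePred p] :
    (uniformOn {S : Finset Y | S.card = t}).real {M | p M} =
      (#((powersetCard t univ).filter p) : ℝ) / (Fintype.card Y).choose t := by
  have h1 : {S : Finset Y | S.card = t} = ((powersetCard t univ : Finset (Finset Y)) : Set _) := by
    ext S; simp [mem_powersetCard]
  have h2 : {M : Finset Y | p M} = ((univ.filter p : Finset (Finset Y)) : Set _) := by
    ext S; simp
  rw [h1, h2, measureReal_def, uniformOn_apply_finset, card_powersetCard, ENNReal.toReal_div]
  simp only [ENNReal.toReal_natCast, card_univ]
  congr 3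
  ext M; simp [mem_powersetCard]

open Finset MeasureTheory ProbabilityTheory in
theorem uniformOn_disjoint_le {Y : Type*} [Fintype Y] {t : ℕ} (hN : 0 < Fintype.card Y)
    (ht : t ≤ Fintype.card Y) (U : Finset Y) :
    (uniformOn {S : Finset Y | S.card = t}).real {M | Disjoint M U} ≤
      (1 - (#U : ℝ) / Fintype.card Y) ^ t := by
  classical
  rw [uniformOn_card_eq_real]
  refine le_trans (le_of_eq ?_) (choose_sub_div_choose_le (card_le_univ U) ht hN)
  rw [← card_compl, ← card_powersetCard]
  congr 3
  ext M
  simp only [mem_filter, mem_powersetCard, subset_univ, true_and, subset_compl_iff_disjoint_right]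
  tauto

open Finset MeasureTheory ProbabilityTheory in
theorem uniformOn_two_le_inter_le {Y : Type*} [Fintype Y] [DecidableEq Y] {t : ℕ}
    (ht : t ≤ Fintype.card Y) (T : Finset Y) :
    (uniformOn {S : Finset Y | S.card = t}).real {M | 2 ≤ #(M ∩ T)} ≤
      min 1 (((#T : ℝ) * t / Fintype.card Y) ^ 2) := by
  refine le_min ?_ ?_
  · have : IsZeroOrProbabilityMeasure (uniformOn {S : Finset Y | S.card = t}) := by
      unfold uniformOn; infer_instance
    exact measureReal_le_one
  · rw [uniformOn_card_eq_real]
    exact card_filter_two_le_inter_div_le ht T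

/-! ### First-moment bound over obstructions -/

open Finset Classical in
/-- The first-moment bound for the obstruction `(T, W)` of `exists_tight_obstruction`. -/
noncomputable def obstructionWeight {X Y : Type*} [Fintype X] [Fintype Y] (B : SimpleGraph (X ⊕ Y))
    (t : ℕ) (T : Finset Y) (W : Finset X) : ℝ :=
  ∏ x, (if x ∈ W then min 1 (((#T : ℝ) * t / Fintype.card Y) ^ 2) else
    (1 - (#(T.filter fun y => B.Adj (Sum.inl x) (Sum.inr y)) : ℝ) / Fintype.card Y) ^ t)

open Finset MeasureTheory ProbabilityTheory Classical in
/-- The first-moment bound for the failure of an `X`-perfect matching in `listSubgraph B M`. -/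
theorem one_sub_sum_le_listLaw {X : Type*} {Y : Type*} [Fintype X] [Fintype Y] {t R : ℕ}
    (hN : 0 < Fintype.card Y) (ht : t ≤ Fintype.card Y)
    (hcard : Fintype.card Y = Fintype.card X + R) (B : SimpleGraph (X ⊕ Y)) :
    1 - ∑ p ∈ (univ : Finset (Finset Y × Finset X)).filter (fun p => #p.2 + R + 1 = #p.1),
        obstructionWeight B t p.1 p.2 ≤
      (listLaw X Y t).real {M | HasXPerfectMatching (listSubgraph B M)} := by
  have hprob : IsProbabilityMeasure (uniformOn {S : Finset Y | S.card = t}) :=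
    isProbabilityMeasure_uniformOn (Set.toFinite _) (by
      obtain ⟨S, -, hS⟩ := exists_subset_card_eq (s := (univ : Finset Y)) (n := t) (by simpa using ht)
      exact ⟨S, hS⟩)
  have hprob' : IsProbabilityMeasure (listLaw X Y t) := by unfold listLaw; infer_instance
  let E : Finset Y × Finset X → X → Set (Finset Y) := fun p x =>
    if x ∈ p.2 then {M | 2 ≤ #(M ∩ p.1)} else
      {M | Disjoint M (p.1.filter fun y => B.Adj (Sum.inl x) (Sum.inr y))}
  set I := (univ : Finset (Finset Y × Finset X)).filter (fun p => #p.2 + R + 1 = #p.1)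
  have hcover : ({M | HasXPerfectMatching (listSubgraph B M)}ᶜ : Set (X → Finset Y)) ⊆
      ⋃ p ∈ I, Set.pi Set.univ (E p) := by
    intro M hM
    let F : X → Finset Y := fun x => (M x).filter fun y => B.Adj (Sum.inl x) (Sum.inr y)
    have hF : ¬ ∃ f : X → Y, Function.Injective f ∧ ∀ x, f x ∈ F x := by
      rintro ⟨f, hf, hfF⟩
      refine hM (hasXPerfectMatching_of_injective f hf fun x => ?_)
      rw [listSubgraph_adj]
      exact (mem_filter.mp (hfF x)).symm
    obtain ⟨T, W, hTW, h2, h0⟩ := exists_tight_obstruction hcard F hF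
    refine Set.mem_biUnion (x := (T, W)) (by simpa [I] using hTW) ?_
    intro x _
    by_cases hx : x ∈ W
    · simp only [E, hx, if_true]
      exact (h2 x hx).trans (card_le_card (inter_subset_inter_right (filter_subset _ _)))
    · simp only [E, hx, if_false]
      refine disjoint_left.mpr fun y hy hyT => ?_
      obtain ⟨hyT, hB⟩ := mem_filter.mp hyT
      exact disjoint_left.mp (h0 x hx) (mem_filter.mpr ⟨hy, hB⟩) hyT
  have hfail : (listLaw X Y t).real {M | HasXPerfectMatching (listSubgraph B M)}ᶜ ≤
      ∑ p ∈ I, ∏ x, (uniformOn {S : Finset Y | S.card = t}).real (E p x) := by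
    refine (measureReal_mono hcover (measure_ne_top _ _)).trans ((measureReal_biUnion_finset_le _ _).trans
      (le_of_eq (sum_congr rfl fun p _ => ?_)))
    simp only [listLaw, measureReal_def, Measure.pi_pi, ENNReal.toReal_prod]
  have hone : 1 ≤ (listLaw X Y t).real {M | HasXPerfectMatching (listSubgraph B M)} +
      (listLaw X Y t).real {M | HasXPerfectMatching (listSubgraph B M)}ᶜ := by
    rw [← probReal_univ (μ := listLaw X Y t), ← Set.union_compl_self
      {M : X → Finset Y | HasXPerfectMatching (listSubgraph B M)}]
    exact measureReal_union_le _ _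
  have hsum : ∑ p ∈ I, ∏ x, (uniformOn {S : Finset Y | S.card = t}).real (E p x) ≤
      ∑ p ∈ I, obstructionWeight B t p.1 p.2 := by
    refine sum_le_sum fun p _ => prod_le_prod (fun _ _ => measureReal_nonneg) fun x _ => ?_
    by_cases hx : x ∈ p.2
    · simp only [E, hx, if_true]
      exact uniformOn_two_le_inter_le ht p.1
    · simp only [E, hx, if_false]
      exact uniformOn_disjoint_le hN ht _
  linarith

section weight

variable {X Y : Type*} [Fintype X] [Fintype Y] (B : SimpleGraph (X ⊕ Y)) (t : ℕ) (T : Finset Y)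
  (W : Finset X)

theorem card_div_card_le_one (S : Finset Y) : (S.card : ℝ) / Fintype.card Y ≤ 1 :=
  div_le_one_of_le₀ (by exact_mod_cast Finset.card_le_univ S) (Nat.cast_nonneg _)

open Finset Classical in
theorem obstructionWeight_eq : obstructionWeight B t T W =
    (min 1 (((#T : ℝ) * t / Fintype.card Y) ^ 2)) ^ #W * ∏ x ∈ Wᶜ,
      (1 - (#(T.filter fun y => B.Adj (Sum.inl x) (Sum.inr y)) : ℝ) / Fintype.card Y) ^ t := by
  rw [obstructionWeight, ← prod_mul_prod_compl W]
  congr 1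
  · rw [prod_congr rfl fun x hx => if_pos hx, prod_const]
  · exact prod_congr rfl fun x hx => if_neg (mem_compl.mp hx)

-- For large `T`: the contacts of `W` are discarded, since the untouched vertices alone suffice.
open Finset Classical in
theorem obstructionWeight_le_pow {p : ℝ} (hp : ∀ x,
    1 - (#(T.filter fun y => B.Adj (Sum.inl x) (Sum.inr y)) : ℝ) / Fintype.card Y ≤ p) :
    obstructionWeight B t T W ≤ (p ^ t) ^ #Wᶜ := by
  rw [obstructionWeight_eq]
  refine (mul_le_of_le_one_left (prod_nonneg fun x _ => ?_) (pow_le_one₀ ?_ (min_le_left _ _))).trans ?_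
  · exact pow_nonneg (sub_nonneg.mpr (card_div_card_le_one _)) _
  · positivity
  · rw [← prod_const]
    exact prod_le_prod (fun x _ => pow_nonneg (sub_nonneg.mpr (card_div_card_le_one _)) _)
      fun x _ => pow_le_pow_left₀ (sub_nonneg.mpr (card_div_card_le_one _)) (hp x) t

-- For small `T`: only the total number of edges from `T` to the complement of `W` matters, so
-- single vertices with few edges do no harm.
open Finset Classical in
theorem obstructionWeight_le_exp {s : ℝ} (hN : 0 < Fintype.card Y)
    (hs : s * Fintype.card Y ≤
      ∑ x ∈ Wᶜ, (#(T.filter fun y => B.Adj (Sum.inl x) (Sum.inr y)) : ℝ)) :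
    obstructionWeight B t T W ≤
      (min 1 (((#T : ℝ) * t / Fintype.card Y) ^ 2)) ^ #W * Real.exp (-(t * s)) := by
  rw [obstructionWeight_eq]
  have hN' : (0 : ℝ) < Fintype.card Y := by exact_mod_cast hN
  gcongr
  calc _ ≤ ∏ x ∈ Wᶜ, Real.exp (-(t * ((#(T.filter fun y => B.Adj (Sum.inl x) (Sum.inr y)) : ℝ) /
            Fintype.card Y))) := by
        refine prod_le_prod (fun x _ => pow_nonneg (sub_nonneg.mpr (card_div_card_le_one _)) _)
          fun x _ => ?_
        rw [← mul_neg, Real.exp_nat_mul]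
        refine pow_le_pow_left₀ (sub_nonneg.mpr (card_div_card_le_one _)) ?_ t
        have := Real.add_one_le_exp
          (-((#(T.filter fun y => B.Adj (Sum.inl x) (Sum.inr y)) : ℝ) / Fintype.card Y))
        linarith
    _ = Real.exp (-(t * ((∑ x ∈ Wᶜ, (#(T.filter fun y => B.Adj (Sum.inl x) (Sum.inr y)) : ℝ)) /
            Fintype.card Y))) := by
        rw [← Real.exp_sum, sum_neg_distrib, ← mul_sum, sum_div]
    _ ≤ _ := by
        gcongr
        rwa [le_div_iff₀ hN']

end weight

/-! ### Binomial sums over subsets -/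

section sums

open Finset

theorem sum_pow_card_finset (α : Type*) [Fintype α] (z : ℝ) :
    ∑ S : Finset α, z ^ #S = (1 + z) ^ Fintype.card α := by
  have := Finset.prod_one_add (f := fun _ : α => z) univ
  simp only [prod_const, card_univ, powerset_univ] at this
  exact this.symm

theorem sum_pow_card_compl (α : Type*) [Fintype α] [DecidableEq α] (z : ℝ) :
    ∑ S : Finset α, z ^ #Sᶜ = (1 + z) ^ Fintype.card α := by
  rw [← sum_pow_card_finset]
  exact Equiv.sum_comp (Function.Involutive.toPerm compl (compl_involutive (α := Finset α)))
    (fun S => z ^ #S)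

theorem one_add_pow_le_exp {z : ℝ} (hz : 0 ≤ z) (k : ℕ) : (1 + z) ^ k ≤ Real.exp (k * z) := by
  rw [Real.exp_nat_mul]
  exact pow_le_pow_left₀ (by linarith) (by linarith [Real.add_one_le_exp z]) k

theorem one_add_pow_sub_one_le {z : ℝ} (hz : 0 ≤ z) {k : ℕ} (h : k * z ≤ 1) :
    (1 + z) ^ k - 1 ≤ 2 * (k * z) := by
  have h1 := one_add_pow_le_exp hz k
  have h0 : 0 ≤ k * z := by positivity
  have h2 := Real.abs_exp_sub_one_le (x := k * z) (by rwa [abs_of_nonneg h0])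
  rw [abs_of_nonneg h0] at h2
  linarith [le_abs_self (Real.exp (k * z) - 1)]

theorem sum_pow_card_nonempty_le (α : Type*) [Fintype α] [DecidableEq α] {z : ℝ} (hz : 0 ≤ z)
    (h : Fintype.card α * z ≤ 1) :
    ∑ S : Finset α, (if S = ∅ then 0 else z ^ #S) ≤ 2 * (Fintype.card α * z) := by
  refine le_trans (le_of_eq ?_) (one_add_pow_sub_one_le hz h)
  rw [← sum_pow_card_finset, ← add_sum_erase univ (fun S : Finset α => z ^ #S) (mem_univ ∅),
    ← add_sum_erase univ _ (mem_univ ∅)]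
  simp only [if_true, card_empty, pow_zero, zero_add, add_sub_cancel_left]
  exact sum_congr rfl fun S hS => if_neg (mem_erase.mp hS).1

end sums

/-! ### Summing the weights over the ranges of `T` -/

section main

open Finset Classical

variable {X Y : Type*} [Fintype X] [Fintype Y]

/-- Obstructions with few vertices in `Y`. -/
theorem exists_small_bound {t : ℕ} (ht : 1 ≤ t) (hXY : Fintype.card X ≤ Fintype.card Y)
    (E : ℝ) (hE : 0 ≤ E) (hr : Fintype.card Y * (Real.exp 1 * t ^ 2 * E) ≤ 1) :
    ∃ f : Finset Y → Finset X → ℝ, (∀ T W, 0 ≤ f T W) ∧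
      (∀ T W, T.Nonempty → #W ≤ #T →
        (min 1 (((#T : ℝ) * t / Fintype.card Y) ^ 2)) ^ #W * E ^ #T ≤ f T W) ∧
      ∑ T, ∑ W, f T W ≤ 2 * (Fintype.card Y * (Real.exp 1 * t ^ 2 * E)) := by
  set N := Fintype.card Y
  have ht' : (1 : ℝ) ≤ t := by exact_mod_cast ht
  have ht2 : (1 : ℝ) ≤ t ^ 2 := one_le_pow₀ ht'
  have hX : (Fintype.card X : ℝ) ≤ N := by exact_mod_cast hXY
  -- The majorant is a power in #W, so the sum over all `W` is binomial. Beyond #T * t² ≤ N the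
  -- minimum is replaced by 1, which is at most (N/#T)^(#T - #W) because #W ≤ #T; there N/#T < t².
  -- Either way the sum over `W` is at most (e t² E)^#T.
  refine ⟨fun T W => if T = ∅ then 0 else if (#T : ℝ) * t ^ 2 ≤ N then
    (((#T : ℝ) * t / N) ^ 2) ^ #W * E ^ #T else
      ((N : ℝ) / #T) ^ #T * ((#T : ℝ) / N) ^ #W * E ^ #T, ?_, ?_, ?_⟩
  · intro T W
    dsimp only
    split_ifs <;> positivity
  · intro T W hT hW
    have hT0 : (0 : ℝ) < #T := by exact_mod_cast hT.card_pos
    have hTN : (#T : ℝ) ≤ N := by exact_mod_cast card_le_univ T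
    dsimp only
    rw [if_neg hT.ne_empty]
    split_ifs with h
    · gcongr
      exact min_le_right _ _
    · gcongr
      refine (pow_le_one₀ (by positivity) (min_le_left _ _)).trans ?_
      have hq : (1 : ℝ) ≤ N / #T := (one_le_div hT0).mpr hTN
      calc (1 : ℝ) = ((N : ℝ) / #T) ^ #W * ((#T : ℝ) / N) ^ #W := by
            rw [← mul_pow, div_mul_div_cancel₀ hT0.ne', div_self (by linarith : (N : ℝ) ≠ 0), one_pow]
        _ ≤ _ := by gcongr
  · refine le_trans (sum_le_sum fun T _ => ?_)
      (sum_pow_card_nonempty_le Y (z := Real.exp 1 * t ^ 2 * E) (by positivity) hr)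
    by_cases hT : T = ∅
    · simp [hT]
    have hT0 : (0 : ℝ) < #T := by exact_mod_cast (nonempty_iff_ne_empty.mpr hT).card_pos
    have hTN : (#T : ℝ) ≤ N := by exact_mod_cast card_le_univ T
    have hN0 : (0 : ℝ) < N := by linarith
    simp only [hT, if_false]
    split_ifs with h
    · rw [← sum_mul, sum_pow_card_finset, mul_pow]
      gcongr
      refine (one_add_pow_le_exp (by positivity) _).trans ?_
      have : (Fintype.card X : ℝ) * ((#T : ℝ) * t / N) ^ 2 ≤ #T := by
        calc _ ≤ (N : ℝ) * ((#T : ℝ) * t / N) ^ 2 := by gcongr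
          _ = #T * (#T * t ^ 2 / N) := by field_simp
          _ ≤ #T * 1 := by gcongr; exact div_le_one_of_le₀ h hN0.le
          _ = _ := mul_one _
      calc _ ≤ Real.exp (#T) := Real.exp_le_exp.mpr this
        _ = Real.exp 1 ^ #T := by rw [← Real.exp_nat_mul, mul_one]
        _ ≤ _ := by gcongr; exact le_mul_of_one_le_right (Real.exp_pos _).le ht2
    · rw [← sum_mul, ← mul_sum, sum_pow_card_finset, mul_pow]
      gcongr
      push Not at h
      have h1 : (1 + (#T : ℝ) / N) ^ Fintype.card X ≤ Real.exp 1 ^ #T := by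
        refine (one_add_pow_le_exp (by positivity) _).trans ?_
        rw [← Real.exp_nat_mul, mul_one]
        refine Real.exp_le_exp.mpr ?_
        rw [mul_div_assoc', div_le_iff₀ hN0, mul_comm]
        gcongr
      have h2 : (N : ℝ) / #T ≤ t ^ 2 := by rw [div_le_iff₀ hT0]; linarith
      rw [mul_comm, mul_pow]
      gcongr

/-- Obstructions that leave few vertices of `X` untouched. -/
theorem sum_large_bound (hN : 0 < Fintype.card Y) (q : ℝ) (hq : 0 ≤ q)
    (hr : Fintype.card X * (Fintype.card Y * q) ≤ 1) :
    ∑ T : Finset Y, ∑ W : Finset X, (if W = univ then 0 else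
      (Fintype.card Y * q) ^ #Wᶜ * (1 / (Fintype.card Y : ℝ)) ^ #Tᶜ) ≤
      2 * (Fintype.card X * (Fintype.card Y * q)) * Real.exp 1 := by
  set N := Fintype.card Y
  have hN' : (0 : ℝ) < N := by exact_mod_cast hN
  have h1 : ∑ W : Finset X, (if W = univ then 0 else (N * q) ^ #Wᶜ) ≤
      2 * (Fintype.card X * (N * q)) := by
    refine le_trans (le_of_eq ?_) (sum_pow_card_nonempty_le X (z := N * q) (by positivity) hr)
    rw [← Equiv.sum_comp (Function.Involutive.toPerm compl (compl_involutive (α := Finset X)))]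
    refine sum_congr rfl fun W _ => ?_
    simp only [Function.Involutive.coe_toPerm, compl_eq_univ_iff, compl_compl]
  have h2 : ∑ T : Finset Y, (1 / (N : ℝ)) ^ #Tᶜ ≤ Real.exp 1 := by
    rw [sum_pow_card_compl]
    refine (one_add_pow_le_exp (by positivity) _).trans (le_of_eq ?_)
    congr 1
    exact mul_one_div_cancel hN'.ne'
  calc _ = (∑ W : Finset X, (if W = univ then 0 else (N * q) ^ #Wᶜ)) *
        ∑ T : Finset Y, (1 / (N : ℝ)) ^ #Tᶜ := by
        rw [sum_mul_sum, sum_comm]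
        refine sum_congr rfl fun W _ => sum_congr rfl fun T _ => ?_
        split_ifs <;> simp
    _ ≤ _ := mul_le_mul h1 h2 (sum_nonneg fun _ _ => by positivity) (by positivity)

theorem sum_obstructionWeight_le {t R : ℕ} {θ g e : ℝ} (hθ : 0 < θ) (hN : 0 < Fintype.card Y)
    (ht : 1 ≤ t) (hcard : Fintype.card Y = Fintype.card X + R) (B : SimpleGraph (X ⊕ Y))
    (heθ : e ≤ θ / 2 * Fintype.card Y) (he : e ≤ Fintype.card Y / 200)
    (hdeg : ∀ x, (#(univ.filter fun y => ¬ B.Adj (Sum.inl x) (Sum.inr y)) : ℝ) ≤ e)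
    (hedge : ∀ (T : Finset Y) (W : Finset X), #W + R + 1 = #T → #T ≤ θ * Fintype.card Y →
      (1 - g) * #T * Fintype.card Y ≤
        ∑ x ∈ Wᶜ, (#(T.filter fun y => B.Adj (Sum.inl x) (Sum.inr y)) : ℝ))
    (h1 : Fintype.card Y * (Real.exp 1 * t ^ 2 * Real.exp (-((1 - g) * t))) ≤ 1)
    (h2 : Fintype.card X * (Fintype.card Y * Real.exp (-(4 * t))) ≤ 1) :
    ∑ p ∈ (univ : Finset (Finset Y × Finset X)).filter (fun p => #p.2 + R + 1 = #p.1),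
        obstructionWeight B t p.1 p.2 ≤
      2 * (Fintype.card Y * (Real.exp 1 * t ^ 2 * Real.exp (-((1 - g) * t)))) +
      2 * (Fintype.card X * (Fintype.card Y * Real.exp (-(4 * t)))) * Real.exp 1 +
      Real.exp (2 * Fintype.card Y - θ / 400 * t * Fintype.card Y) := by
  set N := Fintype.card Y
  have hN' : (0 : ℝ) < N := by exact_mod_cast hN
  have hN1 : (1 : ℝ) ≤ N := by exact_mod_cast hN
  have hXN : Fintype.card X ≤ N := by omega
  obtain ⟨f, hf0, hfw, hfs⟩ := exists_small_bound (X := X) (Y := Y) ht hXN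
    (Real.exp (-((1 - g) * t))) (Real.exp_pos _).le h1
  -- Tightness gives #Wᶜ = #Tᶜ + 1, so the inserted powers of N multiply to N ≥ 1. They make the
  -- sums over `T` and `W` independent, with a convergent factor (1 + 1/N)^N for `T`.
  let f3 : Finset Y → Finset X → ℝ := fun T W => if W = univ then 0 else
      (N * Real.exp (-(4 * t))) ^ #Wᶜ * (1 / (N : ℝ)) ^ #Tᶜ
  have hf3 : ∀ T W, 0 ≤ f3 T W := fun T W => by dsimp only [f3]; split_ifs <;> positivity
  set c := Real.exp (-(θ / 400 * t * N))
  have hc : 0 < c := Real.exp_pos _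
  have hpoint : ∀ p ∈ (univ : Finset (Finset Y × Finset X)).filter
      (fun p => #p.2 + R + 1 = #p.1), obstructionWeight B t p.1 p.2 ≤
        f p.1 p.2 + f3 p.1 p.2 + c := by
    rintro ⟨T, W⟩ hp
    have hTW : #W + R + 1 = #T := (mem_filter.mp hp).2
    by_cases hT : (#T : ℝ) ≤ θ * N
    · have h := obstructionWeight_le_exp B t T W (s := (1 - g) * #T) hN (hedge T W hTW hT)
      have h' : Real.exp (-(t * ((1 - g) * #T))) = Real.exp (-((1 - g) * t)) ^ #T := by
        rw [← Real.exp_nat_mul]; congr 1; ring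
      rw [h'] at h
      have := hfw T W (card_pos.mp (by omega)) (by omega)
      have := hf3 T W
      dsimp only
      linarith
    · push Not at hT
      have hWX : #W ≤ Fintype.card X := card_le_univ W
      have hTY : #T ≤ N := card_le_univ T
      have hTc : #Tᶜ + #T = N := card_compl_add_card T
      have hWc : #Wᶜ + #W = Fintype.card X := card_compl_add_card W
      have hTWc : #Wᶜ = #Tᶜ + 1 := by omega
      have hTc' : (#Wᶜ : ℝ) = N - #T + 1 := by
        have h : #Wᶜ + #T = N + 1 := by omega
        have : (#Wᶜ : ℝ) + #T = N + 1 := by exact_mod_cast h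
        linarith
      have hd : ∀ x, 1 - (#(T.filter fun y => B.Adj (Sum.inl x) (Sum.inr y)) : ℝ) / N ≤
          1 - (#T - e) / N := by
        intro x
        have h3 : #T ≤ #(T.filter fun y => B.Adj (Sum.inl x) (Sum.inr y)) +
            #(univ.filter fun y => ¬ B.Adj (Sum.inl x) (Sum.inr y)) := by
          rw [← card_filter_add_card_filter_not (s := T)
            (fun y => B.Adj (Sum.inl x) (Sum.inr y))]
          gcongr
          exact subset_univ _
        have h4 : (#T : ℝ) ≤ #(T.filter fun y => B.Adj (Sum.inl x) (Sum.inr y)) +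
            #(univ.filter fun y => ¬ B.Adj (Sum.inl x) (Sum.inr y)) := by exact_mod_cast h3
        have := hdeg x
        gcongr
        linarith
      -- Below N/200, #T exceeds 199N/200, and losing e ≤ N/200 leaves 99N/100; then 1/100 ≤ e^(-4).
      by_cases ha : (N : ℝ) / 200 ≤ #Wᶜ
      · have h5 : 1 - (#T - e) / N ≤ Real.exp (-(θ / 2)) := by
          have : θ / 2 ≤ (#T - e) / N := by rw [le_div_iff₀ hN']; linarith
          linarith [Real.add_one_le_exp (-(θ / 2))]
        have h := obstructionWeight_le_pow B t T W (fun x => (hd x).trans h5)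
        have h6 : (Real.exp (-(θ / 2)) ^ t) ^ #Wᶜ ≤ c := by
          rw [← pow_mul, ← Real.exp_nat_mul]
          refine Real.exp_le_exp.mpr ?_
          push_cast
          have : (t : ℝ) * (θ / 2) * (N / 200) ≤ t * (θ / 2) * #Wᶜ := by gcongr
          linarith
        have := hf0 T W
        have := hf3 T W
        dsimp only
        linarith
      · push Not at ha
        have h5 : 1 - (#T - e) / N ≤ Real.exp (-4) := by
          have h6 : 99 / 100 ≤ (#T - e) / N := by rw [le_div_iff₀ hN']; linarith
          have h7 : Real.exp 4 ≤ 100 := by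
            have : Real.exp 4 = Real.exp 1 ^ 4 := by rw [← Real.exp_nat_mul]; norm_num
            rw [this]
            calc Real.exp 1 ^ 4 ≤ 3 ^ 4 := by gcongr; linarith [Real.exp_one_lt_d9]
              _ ≤ 100 := by norm_num
          have h8 : (1 : ℝ) / 100 ≤ Real.exp (-4) := by
            rw [Real.exp_neg, ← one_div]; gcongr
          linarith
        have h := obstructionWeight_le_pow B t T W (fun x => (hd x).trans h5)
        have h6 : (Real.exp (-4) ^ t) ^ #Wᶜ ≤ f3 T W := by
          have hWu : W ≠ univ := by
            rintro rfl
            simp at hTWc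
          have h7 : Real.exp (-4) ^ t = Real.exp (-(4 * t)) := by
            rw [← Real.exp_nat_mul]; congr 1; ring
          simp only [f3, hWu, if_false]
          rw [h7, mul_pow, hTWc, one_div, inv_pow, mul_right_comm]
          refine le_mul_of_one_le_left (by positivity) ?_
          rw [pow_succ, mul_right_comm, mul_inv_cancel₀ (by positivity), one_mul]
          exact hN1
        have := hf0 T W
        dsimp only
        linarith
  have hcount : ∑ _p : Finset Y × Finset X, c ≤ Real.exp (2 * N - θ / 400 * t * N) := by
    rw [sum_const, card_univ, Fintype.card_prod, Fintype.card_finset, Fintype.card_finset,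
      nsmul_eq_mul, sub_eq_add_neg, Real.exp_add]
    gcongr
    push_cast
    calc (2 : ℝ) ^ N * 2 ^ Fintype.card X ≤ 2 ^ N * 2 ^ N := by
          gcongr
          norm_num
      _ ≤ Real.exp 1 ^ N * Real.exp 1 ^ N := by
          have : (2 : ℝ) ≤ Real.exp 1 := by linarith [Real.exp_one_gt_d9]
          gcongr
      _ = _ := by rw [← Real.exp_nat_mul, ← Real.exp_add]; congr 1; ring
  calc _ ≤ ∑ p ∈ (univ : Finset (Finset Y × Finset X)).filter
        (fun p => #p.2 + R + 1 = #p.1), (f p.1 p.2 + f3 p.1 p.2 + c) := sum_le_sum hpoint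
    _ ≤ ∑ p : Finset Y × Finset X, (f p.1 p.2 + f3 p.1 p.2 + c) := by
        refine sum_le_sum_of_subset_of_nonneg (filter_subset _ _) fun p _ _ => ?_
        have := hf0 p.1 p.2
        have := hf3 p.1 p.2
        positivity
    _ = ∑ T, ∑ W, f T W + ∑ T, ∑ W, f3 T W + ∑ _p : Finset Y × Finset X, c := by
        rw [sum_add_distrib, sum_add_distrib, Fintype.sum_prod_type, Fintype.sum_prod_type]
    _ ≤ _ := add_le_add (add_le_add hfs
        (sum_large_bound hN _ (Real.exp_pos _).le h2)) hcount

end main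

/-! ### Edges of `B` leaving a small `T` -/

section edges

open Finset Classical

variable {X Y : Type*} [Fintype X] [Fintype Y] (B : SimpleGraph (X ⊕ Y))

theorem card_not_adj_le_ncard_neighborSet (x : X) :
    #(univ.filter fun y => ¬ B.Adj (Sum.inl x) (Sum.inr y)) ≤
      ((bipCompl B).neighborSet (Sum.inl x)).ncard := by
  rw [← Set.ncard_coe_finset, ← Set.ncard_image_of_injective _ (Sum.inr_injective (α := X))]
  refine Set.ncard_le_ncard ?_ (Set.toFinite _)
  rintro _ ⟨y, hy, rfl⟩
  simpa [bipCompl] using hy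

theorem sum_card_not_adj_le_ncard_edgeSet :
    ∑ y, #(univ.filter fun x => ¬ B.Adj (Sum.inl x) (Sum.inr y)) ≤
      (bipCompl B).edgeSet.ncard := by
  have h : ∑ y, #(univ.filter fun x => ¬ B.Adj (Sum.inl x) (Sum.inr y)) =
      #(univ.filter fun p : Y × X => ¬ B.Adj (Sum.inl p.2) (Sum.inr p.1)) := by
    simp only [card_filter]
    rw [Fintype.sum_prod_type]
  have hinj : Function.Injective (fun p : Y × X => s((Sum.inl p.2 : X ⊕ Y), Sum.inr p.1)) := by
    rintro ⟨y, x⟩ ⟨y', x'⟩ h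
    simpa [and_comm] using h
  rw [h, ← Set.ncard_coe_finset, ← Set.ncard_image_of_injective _ hinj]
  refine Set.ncard_le_ncard ?_ (Set.toFinite _)
  rintro _ ⟨p, hp, rfl⟩
  simpa [bipCompl] using hp

/-- If few vertices of `Y` have large degree in the bipartite complement, then any `T ⊆ Y` sends
many edges to the complement of any small `W ⊆ X`. -/
theorem le_sum_card_adj {R : ℕ} {θ s : ℝ} (hθ : 0 ≤ θ)
    (hbad : (#(univ.filter fun y =>
      s < #(univ.filter fun x => ¬ B.Adj (Sum.inl x) (Sum.inr y))) : ℝ) ≤ θ * R)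
    {T : Finset Y} {W : Finset X} (hTW : #W + R + 1 = #T)
    (hs : 0 ≤ (Fintype.card X : ℝ) - #T - s) :
    (1 - θ) * #T * (Fintype.card X - #T - s) ≤
      ∑ x ∈ Wᶜ, (#(T.filter fun y => B.Adj (Sum.inl x) (Sum.inr y)) : ℝ) := by
  set bad := univ.filter fun y => s < #(univ.filter fun x => ¬ B.Adj (Sum.inl x) (Sum.inr y))
  have hR : (R : ℝ) ≤ #T := by exact_mod_cast (by omega : R ≤ #T)
  have hWT : (#W : ℝ) ≤ #T := by exact_mod_cast (by omega : #W ≤ #T)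
  -- Tightness forces R < #T, so the exceptional vertices are at most a θ-fraction of `T`.
  have hT' : (1 - θ) * #T ≤ #(T \ bad) := by
    have h : #T ≤ #(T \ bad) + #bad := by
      have := le_card_sdiff bad T
      omega
    have h' : (#T : ℝ) ≤ #(T \ bad) + #bad := by exact_mod_cast h
    have : θ * R ≤ θ * #T := by gcongr
    linarith
  have hswap : ∑ x ∈ Wᶜ, (#(T.filter fun y => B.Adj (Sum.inl x) (Sum.inr y)) : ℝ) =
      ∑ y ∈ T, (#(Wᶜ.filter fun x => B.Adj (Sum.inl x) (Sum.inr y)) : ℝ) := by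
    simp only [card_filter, Nat.cast_sum]
    exact sum_comm
  rw [hswap]
  calc (1 - θ) * #T * (Fintype.card X - #T - s) ≤ #(T \ bad) * (Fintype.card X - #T - s) := by
        gcongr
    _ = ∑ y ∈ T \ bad, ((Fintype.card X : ℝ) - #T - s) := by rw [sum_const, nsmul_eq_mul]
    _ ≤ ∑ y ∈ T \ bad, (#(Wᶜ.filter fun x => B.Adj (Sum.inl x) (Sum.inr y)) : ℝ) := by
        refine sum_le_sum fun y hy => ?_
        have h1 : (#(univ.filter fun x => ¬ B.Adj (Sum.inl x) (Sum.inr y)) : ℝ) ≤ s := by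
          have := (mem_sdiff.mp hy).2
          simpa [bad] using this
        have h2 : Fintype.card X ≤ #W + #(Wᶜ.filter fun x => B.Adj (Sum.inl x) (Sum.inr y)) +
            #(univ.filter fun x => ¬ B.Adj (Sum.inl x) (Sum.inr y)) := by
          rw [← card_add_card_compl W, add_assoc]
          gcongr
          rw [← card_filter_add_card_filter_not (s := Wᶜ)
            (fun x => B.Adj (Sum.inl x) (Sum.inr y))]
          gcongr
          exact subset_univ _
        have h3 : (Fintype.card X : ℝ) ≤ #W +
            #(Wᶜ.filter fun x => B.Adj (Sum.inl x) (Sum.inr y)) +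
            #(univ.filter fun x => ¬ B.Adj (Sum.inl x) (Sum.inr y)) := by exact_mod_cast h2
        linarith
    _ ≤ _ := sum_le_sum_of_subset_of_nonneg sdiff_subset fun _ _ _ => Nat.cast_nonneg _

/-- Markov's inequality for degrees in the bipartite complement. -/
theorem card_large_codegree_mul_le {s : ℝ} :
    (#(univ.filter fun y =>
      s < #(univ.filter fun x => ¬ B.Adj (Sum.inl x) (Sum.inr y))) : ℝ) * s ≤
      (bipCompl B).edgeSet.ncard := by
  set bad := univ.filter fun y => s < #(univ.filter fun x => ¬ B.Adj (Sum.inl x) (Sum.inr y))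
  calc (#bad : ℝ) * s = ∑ y ∈ bad, s := by rw [sum_const, nsmul_eq_mul]
    _ ≤ ∑ y ∈ bad, (#(univ.filter fun x => ¬ B.Adj (Sum.inl x) (Sum.inr y)) : ℝ) :=
        sum_le_sum fun y hy => (mem_filter.mp hy).2.le
    _ ≤ ∑ y, (#(univ.filter fun x => ¬ B.Adj (Sum.inl x) (Sum.inr y)) : ℝ) :=
        sum_le_sum_of_subset_of_nonneg (filter_subset _ _) fun _ _ _ => Nat.cast_nonneg _
    _ ≤ _ := by exact_mod_cast sum_card_not_adj_le_ncard_edgeSet B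

end edges

/-! ### Asymptotics and choice of parameters -/

open Filter Topology Real in
/-- The estimates that hold once `L = log n` is large. -/
theorem eventually_estimates (δ θ c : ℝ) (hδ : 0 < δ) (hc : 0 < c) :
    ∀ᶠ L : ℝ in atTop,
      4 * exp 2 * (((1 + δ) * L + 1) ^ 2 * exp (-(δ / 2) * L)) ≤ min 1 (c / 6) ∧
      16 * exp 4 * exp (-L) ≤ min 1 (c / 18) ∧
      exp 1 * exp (-δ * L) ≤ c / 3 ∧ 1600 / θ ≤ (1 + δ) * L - 1 ∧ 1 ≤ L := by
  have hmin1 : 0 < min 1 (c / 6) := by positivity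
  have hmin2 : 0 < min 1 (c / 18) := by positivity
  have hlin : Tendsto (fun L : ℝ => (1 + δ) * L) atTop atTop :=
    tendsto_id.const_mul_atTop (by linarith)
  have hpoly : Tendsto (fun L : ℝ => ((1 + δ) * L + 1) ^ 2 * exp (-(δ / 2) * L)) atTop (𝓝 0) := by
    have h (k : ℕ) : Tendsto (fun L : ℝ => L ^ k * exp (-(δ / 2) * L)) atTop (𝓝 0) := by
      have := tendsto_rpow_mul_exp_neg_mul_atTop_nhds_zero (k : ℝ) (δ / 2) (by positivity)
      simpa only [rpow_natCast] using this
    have := (((h 2).const_mul ((1 + δ) ^ 2)).add ((h 1).const_mul (2 * (1 + δ)))).add (h 0)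
    simp only [mul_zero, add_zero] at this
    refine this.congr fun L => ?_
    ring
  have hexp (a : ℝ) (ha : 0 < a) : Tendsto (fun L : ℝ => exp (-a * L)) atTop (𝓝 0) := by
    have := tendsto_rpow_mul_exp_neg_mul_atTop_nhds_zero 0 a ha
    simpa only [rpow_zero, one_mul] using this
  have e1 := (hpoly.const_mul (4 * exp 2)).eventually_le_const (u := min 1 (c / 6)) (by simpa using hmin1)
  have e2 := ((hexp 1 one_pos).const_mul (16 * exp 4)).eventually_le_const (u := min 1 (c / 18)) (by simpa using hmin2)
  have e3 := ((hexp δ hδ).const_mul (exp 1)).eventually_le_const (u := c / 3)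
    (by simpa using (by positivity : 0 < c / 3))
  filter_upwards [e1, e2, e3, hlin.eventually_ge_atTop (1600 / θ + 1), eventually_ge_atTop 1]
    with L h1 h2 h3 h4 h5
  refine ⟨h1, ?_, h3, by linarith, h5⟩
  simpa only [neg_mul, one_mul] using h2

open Real in
theorem error_terms_le {δ θ c g N m D n t : ℝ} (hδ : 0 < δ) (hθ : 0 < θ)
    (hg : (1 - g) * (1 + δ) = 1 + δ / 2) (hg0 : 0 ≤ g) (hg1 : g ≤ 1)
    (hD : 1 ≤ D) (hDn : D ≤ n) (ht : |t - (1 + δ) * log n| < 1)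
    (h1 : 4 * exp 2 * (((1 + δ) * log n + 1) ^ 2 * exp (-(δ / 2) * log n)) ≤ min 1 (c / 6))
    (h2 : 16 * exp 4 * exp (-log n) ≤ min 1 (c / 18))
    (h3 : exp 1 * exp (-δ * log n) ≤ c / 3) (h4 : 1600 / θ ≤ (1 + δ) * log n - 1)
    (h5 : 1 ≤ log n) (hm : 0 ≤ m) (hmN : m ≤ N) (hND : N ≤ 4 * D) (hNθ : 800 / θ ≤ N) :
    N * (exp 1 * t ^ 2 * exp (-((1 - g) * t))) ≤ 1 ∧ m * (N * exp (-(4 * t))) ≤ 1 ∧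
    2 * (N * (exp 1 * t ^ 2 * exp (-((1 - g) * t)))) + 2 * (m * (N * exp (-(4 * t)))) * exp 1 +
      exp (2 * N - θ / 400 * t * N) ≤ c * (D / n) := by
  obtain ⟨ht1, ht2⟩ := abs_lt.mp ht
  set L := log n
  have hn0 : 0 < n := by linarith
  have hexpL : exp (-L) = 1 / n := by rw [exp_neg, exp_log hn0, one_div]
  have hDn0 : 0 < D / n := by positivity
  have hDn1 : D / n ≤ 1 := (div_le_one hn0).mpr hDn
  have hN0 : 0 ≤ N := hm.trans hmN
  have ht0 : 0 ≤ t := by nlinarith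
  have hc : 0 ≤ c / 3 := le_trans (by positivity) h3
  have hc' : 0 ≤ min 1 (c / 18) := le_trans (by positivity) h2
  have a1 : N * (exp 1 * t ^ 2 * exp (-((1 - g) * t))) ≤ min 1 (c / 6) * (D / n) := by
    have e1 : exp (-((1 - g) * t)) ≤ exp 1 * (exp (-(δ / 2) * L) * (1 / n)) := by
      rw [← hexpL, ← exp_add, ← exp_add]
      refine exp_le_exp.mpr ?_
      have : (1 - g) * ((1 + δ) * L - 1) ≤ (1 - g) * t :=
        mul_le_mul_of_nonneg_left (by linarith) (by linarith)
      have : (1 - g) * ((1 + δ) * L - 1) = (1 + δ / 2) * L - (1 - g) := by rw [← hg]; ring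
      linarith
    have e2 : t ^ 2 ≤ ((1 + δ) * L + 1) ^ 2 := pow_le_pow_left₀ ht0 (by linarith) 2
    calc _ ≤ (4 * D) * (exp 1 * ((1 + δ) * L + 1) ^ 2 *
          (exp 1 * (exp (-(δ / 2) * L) * (1 / n)))) := by gcongr
      _ = 4 * exp 2 * (((1 + δ) * L + 1) ^ 2 * exp (-(δ / 2) * L)) * (D / n) := by
        rw [(by norm_num : (2 : ℝ) = 1 + 1), exp_add]; ring
      _ ≤ _ := by gcongr
  have a2 : m * (N * exp (-(4 * t))) ≤ min 1 (c / 18) * (D / n) := by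
    -- Two factors 1/n pair with D²; the remaining exp (-L) supplies the small constant.
    have e1 : exp (-(4 * t)) ≤ exp 4 * (exp (-L) * ((1 / n) * (1 / n))) := by
      rw [← hexpL, ← exp_add, ← exp_add, ← exp_add]
      refine exp_le_exp.mpr ?_
      nlinarith
    calc _ ≤ (4 * D) * ((4 * D) * (exp 4 * (exp (-L) * ((1 / n) * (1 / n))))) := by
          gcongr
          linarith
      _ = 16 * exp 4 * exp (-L) * ((D / n) * (D / n)) := by ring
      _ ≤ min 1 (c / 18) * ((D / n) * 1) := by gcongr
      _ = _ := by rw [mul_one]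
  have a3 : exp (2 * N - θ / 400 * t * N) ≤ c / 3 * (D / n) := by
    -- Half of the negative term absorbs 2N because θt ≥ 1600, the other half absorbs t because θN ≥
    -- 800.
    have e1 : 2 * N - θ / 400 * t * N ≤ -t := by
      have b1 : 1600 ≤ θ * t := by
        rw [mul_comm, ← div_le_iff₀ hθ]; linarith
      have b2 : 800 ≤ θ * N := by rw [mul_comm, ← div_le_iff₀ hθ]; linarith
      have b3 : 1600 * N ≤ θ * t * N := by gcongr
      have b4 : 800 * t ≤ θ * N * t := by gcongr
      linarith
    calc _ ≤ exp 1 * exp (-δ * L) * (1 / n) := by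
          rw [← hexpL, ← exp_add, ← exp_add]
          exact exp_le_exp.mpr (by linarith)
      _ ≤ c / 3 * (D / n) := by gcongr
  have hx : exp 1 ≤ 3 := by linarith [exp_one_lt_d9]
  have a1' : min 1 (c / 6) * (D / n) ≤ c / 6 * (D / n) := by gcongr; exact min_le_right _ _
  have a2' : min 1 (c / 18) * (D / n) ≤ c / 18 * (D / n) := by gcongr; exact min_le_right _ _
  refine ⟨a1.trans (mul_le_one₀ (min_le_left _ _) hDn0.le hDn1),
    a2.trans (mul_le_one₀ (min_le_left _ _) hDn0.le hDn1), ?_⟩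
  have a4 : 2 * (m * (N * exp (-(4 * t)))) * exp 1 ≤ 2 * (c / 18 * (D / n)) * 3 := by
    have := a2.trans a2'
    have : 0 ≤ c / 18 * (D / n) := by have : 0 ≤ c := by linarith
                                      positivity
    gcongr
  linarith

/-- Numerical consequences of the hypotheses on the parameters. -/
theorem parameter_bounds {κ θ b ε ζ₀ ζ η D : ℝ} {m R : ℝ} (hκ : 0 < κ) (hκ8 : κ ≤ 1 / 8)
    (hθ : 0 < θ) (hθ1 : θ < 1) (hκθ : 4 * κ ≤ θ ^ 2) (hb : 0 < b) (hbθ : 4 * b * κ ≤ θ)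
    (hb1 : 400 * b * κ ≤ 1) (hD : 0 < D) (hε : MuchLess κ ε (ζ₀ * D))
    (hζ₀ : MuchLess κ (ζ₀ * D) 1) (hm : ApproxEq κ m D) (hR0 : 0 ≤ R) (hsmall : ζ < ζ₀ → R = 0)
    (hlarge : ζ₀ ≤ ζ → MuchLess κ (max ζ (1 / D)) η ∧ MuchLess κ R D ∧ ApproxLE κ (η * D) R) :
    m + R ≤ 4 * D ∧ D ≤ 2 * (m + R) ∧ (1 - 2 * κ) * (m + R) ≤ m ∧
      b * (ε * D) ≤ θ / 2 * (m + R) ∧ b * (ε * D) ≤ (m + R) / 200 ∧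
      ∀ k : ℕ, k * (θ * D) ≤ 2 * ζ * D ^ 2 → (k : ℝ) ≤ θ * R := by
  unfold ApproxEq MuchLess at hm
  unfold MuchLess at hε hζ₀ hlarge
  unfold ApproxLE at hlarge
  obtain ⟨hm1, hm2⟩ := abs_lt.mp hm
  have hm0 : 0 < m := by
    have : 0 < κ * m := (abs_nonneg _).trans_lt hm
    exact pos_of_mul_pos_right this hκ.le
  have hκm : κ * m ≤ 1 / 8 * m := by gcongr
  have hκD : κ * D ≤ 1 / 8 * D := by gcongr
  have hRκ : R ≤ κ * D := by
    rcases lt_or_ge ζ ζ₀ with h | h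
    · rw [hsmall h]; positivity
    · exact (hlarge h).2.1.le
  have hD2 : D ≤ 2 * m := by linarith
  have hRm : R ≤ 2 * κ * m := by nlinarith
  have hεκ : b * (ε * D) ≤ b * κ * κ * D := by
    have h1 : ε ≤ κ * κ := by
      have : κ * (ζ₀ * D) ≤ κ * (κ * 1) := by gcongr
      linarith
    calc b * (ε * D) ≤ b * (κ * κ * D) := by gcongr
      _ = _ := by ring
  refine ⟨by linarith, by linarith, ?_, ?_, ?_, ?_⟩
  · have : 0 ≤ κ * R := by positivity
    linarith
  · have : 4 * b * κ * (κ * D) ≤ θ * (κ * D) := by gcongr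
    have : θ * (κ * D) ≤ θ * (2 * (m + R)) :=
      mul_le_mul_of_nonneg_left (by linarith) hθ.le
    linarith
  · have : 400 * b * κ * (κ * D) ≤ 1 * (κ * D) := by gcongr
    linarith
  · intro k hk
    have hk0 : (0 : ℝ) ≤ k := Nat.cast_nonneg _
    rcases lt_or_ge ζ ζ₀ with h | h
    · have h1 : (k : ℝ) * (θ * D) < 1 * (θ * D) := by
        have h2 : ζ * D * D ≤ ζ₀ * D * D := by gcongr
        have h3 : ζ₀ * D * D < κ * 1 * D := by gcongr
        have h4 : 4 * κ * D ≤ θ ^ 2 * D := by gcongr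
        have h5 : θ * (θ * D) ≤ 1 * (θ * D) := by gcongr
        have : 0 < κ * D := by positivity
        linarith
      have h2 : (k : ℝ) < 1 := lt_of_mul_lt_mul_right h1 (by positivity)
      have h3 : k = 0 := by
        have : k < 1 := by exact_mod_cast h2
        omega
      rw [h3, hsmall h]
      simp
    · obtain ⟨hη, -, hηR⟩ := hlarge h
      have h1 : ζ ≤ κ * η := (le_max_left _ _).trans hη.le
      have h2 : 2 * ζ * D ^ 2 ≤ θ * R * (θ * D) := by
        calc 2 * ζ * D ^ 2 ≤ 2 * (κ * η) * D ^ 2 := by gcongr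
          _ = 2 * κ * D * (η * D) := by ring
          _ ≤ 2 * κ * D * ((1 + κ) * R) := by gcongr
          _ ≤ 2 * κ * D * (2 * R) := by gcongr; linarith
          _ = 4 * κ * (R * D) := by ring
          _ ≤ θ ^ 2 * (R * D) := by gcongr
          _ = _ := by ring
      exact le_of_mul_le_mul_right (hk.trans h2) (by positivity)

/-! ### Assembly -/

theorem lemma7p3 (δ' : ℝ) (hδ' : 0 < δ') (b : ℝ) (hb : 0 < b) :
    ∃ κ : ℝ, 0 < κ ∧
      ∀ ε : ℝ, 0 < ε → ∀ c : ℝ, 0 < c →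
      ∃ D₀ : ℕ, ∀ D : ℕ, D₀ ≤ D → ∀ n : ℕ, D ≤ n →
      ∀ t : ℕ, |(t : ℝ) - (1 + δ') * Real.log n| < 1 →
      ∀ ζ₀ ζ η : ℝ, MuchLess κ ε (ζ₀ * D) → MuchLess κ (ζ₀ * D) 1 →
      ∀ (J R : ℕ) (X : Type u) (Y : Type v) [Fintype X] [Fintype Y],
        Fintype.card X = J → ApproxEq κ J D → Fintype.card Y = J + R → t ≤ J + R →
      ∀ B : SimpleGraph (X ⊕ Y), B ≤ completeBipartiteGraph X Y →
        (∀ x : X, (((bipCompl B).neighborSet (Sum.inl x)).ncard : ℝ) ≤ b * (ε * D)) →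
        ((bipCompl B).edgeSet.ncard : ℝ) ≤ 2 * ζ * (D : ℝ) ^ 2 →
        (ζ < ζ₀ → R = 0) →
        (ζ₀ ≤ ζ →
          MuchLess κ (max ζ (1 / (D : ℝ))) η ∧ MuchLess κ η (ζ / ε) ∧
          MuchLess κ R D ∧ ApproxLE κ (η * D) R) →
        1 - c * ((D : ℝ) / n) ≤
          (listLaw X Y t).real {M | HasXPerfectMatching (listSubgraph B M)} := by
  classical
  -- This `g` spends half of the surplus δ', leaving the exponent 1 + δ'/2.
  set g : ℝ := δ' / (2 * (1 + δ')) with hgdef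
  have hg0 : 0 < g := by positivity
  have hg1 : g ≤ 1 / 2 := by
    rw [hgdef, div_le_div_iff₀ (by positivity) (by norm_num)]; linarith
  have hg : (1 - g) * (1 + δ') = 1 + δ' / 2 := by
    rw [hgdef]; field_simp; ring
  set θ : ℝ := g / 6 with hθdef
  have hθ : 0 < θ := by positivity
  have hθ1 : θ ≤ 1 / 12 := by linarith
  have h400 : 0 < 1 / (400 * b) := by positivity
  have hθb : 0 < θ / (4 * b) := by positivity
  obtain ⟨κ, hκ, hκle⟩ : ∃ κ : ℝ, 0 < κ ∧
      κ ≤ min (min (1 / 8) (θ ^ 2 / 4)) (min (θ / (4 * b)) (1 / (400 * b))) :=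
    ⟨_, by positivity, le_rfl⟩
  simp only [le_min_iff] at hκle
  obtain ⟨⟨hκ8, hκθ⟩, hκb, hκb'⟩ := hκle
  rw [le_div_iff₀ (by positivity)] at hκb hκb'
  have hκθ' : κ ≤ θ := by nlinarith
  refine ⟨κ, hκ, fun ε hε c hc => ?_⟩
  obtain ⟨L₀, hL₀⟩ := Filter.eventually_atTop.mp (eventually_estimates δ' θ c hδ' hc)
  -- exp L₀ forces log n ≥ L₀ through n ≥ D; 1600/θ forces N ≥ 800/θ through N ≥ D/2.
  obtain ⟨D₀, hD₀⟩ := exists_nat_ge (Real.exp L₀ + 1600 / θ + 1)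
  refine ⟨D₀, ?_⟩
  intro D hD n hDn t ht ζ₀ ζ η hεζ hζ₀ J R X Y _ _ hX hJ hY htN B _ hdeg hedges hsmall hlarge
  have hDreal : Real.exp L₀ + 1600 / θ + 1 ≤ (D : ℝ) := hD₀.trans (by exact_mod_cast hD)
  have h1600 : 0 < 1600 / θ := by positivity
  have hexp0 : 0 < Real.exp L₀ := Real.exp_pos _
  have hD1 : (1 : ℝ) ≤ D := by linarith
  have hDn' : (D : ℝ) ≤ n := by exact_mod_cast hDn
  have hL : L₀ ≤ Real.log n := by
    rw [Real.le_log_iff_exp_le (by linarith)]; linarith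
  obtain ⟨e1, e2, e3, e4, e5⟩ := hL₀ (Real.log n) hL
  obtain ⟨p1, p2, p3, p4, p5, p6⟩ := parameter_bounds (m := (J : ℝ)) (R := (R : ℝ)) (D := (D : ℝ))
    hκ hκ8 hθ (by linarith) (by linarith) hb (by linarith) (by linarith) (by linarith) hεζ hζ₀ hJ
    (Nat.cast_nonneg _) (fun h => by rw [hsmall h, Nat.cast_zero])
    (fun h => ⟨(hlarge h).1, (hlarge h).2.2⟩)
  have hYr : (Fintype.card Y : ℝ) = J + R := by rw [hY]; push_cast; rfl
  have hXr : (Fintype.card X : ℝ) = J := by rw [hX]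
  rw [← hYr] at p1 p2 p3 p4 p5
  rw [← hXr] at p3
  have hN0 : 0 < Fintype.card Y := by
    have : (0 : ℝ) < Fintype.card Y := by linarith
    exact_mod_cast this
  have ht1 : 1 ≤ t := by
    have h1 := (abs_lt.mp ht).1
    have : (0 : ℝ) < t := by nlinarith
    exact_mod_cast this
  have hcard : Fintype.card Y = Fintype.card X + R := by rw [hX, hY]
  have hN800 : 800 / θ ≤ Fintype.card Y := by
    have : 1600 / θ = 2 * (800 / θ) := by ring
    linarith
  have htY : t ≤ Fintype.card Y := by rw [hY]; exact htN
  have hXY : (Fintype.card X : ℝ) ≤ Fintype.card Y := by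
    rw [hcard, Nat.cast_add]; linarith [(Nat.cast_nonneg R : (0 : ℝ) ≤ R)]
  obtain ⟨q1, q2, q3⟩ := error_terms_le (N := (Fintype.card Y : ℝ)) (m := (Fintype.card X : ℝ))
    hδ' hθ hg hg0.le (by linarith) hD1 hDn' ht e1 e2 e3 e4 e5 (Nat.cast_nonneg _)
    hXY p1 hN800
  have hbad := p6 _ ((card_large_codegree_mul_le B (s := θ * D)).trans hedges)
  have hsum := sum_obstructionWeight_le (t := t) (R := R) (θ := θ) (g := g) (e := b * (ε * D)) hθ
    hN0 ht1 hcard B p4 p5 (fun x =>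
      le_trans (Nat.cast_le.mpr (card_not_adj_le_ncard_neighborSet B x)) (hdeg x)) ?_ q1 q2
  · refine le_trans ?_ (one_sub_sum_le_listLaw hN0 htY hcard B)
    exact sub_le_sub_left (hsum.trans q3) 1
  · intro T W hTW hT
    have hN0' : (0 : ℝ) < Fintype.card Y := by exact_mod_cast hN0
    -- The loss 5θ is 2κ ≤ 2θ from |X| against N, θ from `T`, and 2θ from θD ≤ 2θN; one more θ for
    -- exceptional vertices gives 6θ = g.
    have h1 : (1 - 5 * θ) * Fintype.card Y ≤ (Fintype.card X : ℝ) - T.card - θ * D := by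
      have : θ * D ≤ θ * (2 * Fintype.card Y) := by gcongr
      have : κ * Fintype.card Y ≤ θ * Fintype.card Y := by gcongr
      linarith
    have h2 : 0 ≤ (1 - 5 * θ) * (Fintype.card Y : ℝ) := mul_nonneg (by linarith) hN0'.le
    refine le_trans ?_ (le_sum_card_adj B hθ.le hbad hTW (h2.trans h1))
    have h3 : 1 - g ≤ (1 - θ) * (1 - 5 * θ) := by
      have h4 : (1 - θ) * (1 - 5 * θ) = 1 - 6 * θ + 5 * θ ^ 2 := by ring
      have h5 : 0 ≤ θ ^ 2 := sq_nonneg θ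
      rw [h4]
      linarith
    calc (1 - g) * T.card * Fintype.card Y
        ≤ (1 - θ) * (1 - 5 * θ) * T.card * Fintype.card Y := by gcongr
      _ = (1 - θ) * T.card * ((1 - 5 * θ) * Fintype.card Y) := by ring
      _ ≤ _ := by
        refine mul_le_mul_of_nonneg_left h1 (mul_nonneg (by linarith) (Nat.cast_nonneg _))
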